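/- Let $N\ge 3$ and $1<p<N$. Let $A:(0,\infty)\to(0,\infty)$ be continuous and suppose there are $a_0,a_\infty\in(p-N,p]$ such that $$0<\liminf_{r\to0^+}\frac{A(r)}{r^{a_0}}\le\limsup_{r\to0^+}\frac{A(r)}{r^{a_0}}<\infty,\qquad 0<\liminf_{r\to\infty}\frac{A(r)}{r^{a_\infty}}\le\limsup_{r\to\infty}\frac{A(r)}{r^{a_\infty}}<\infty .$$ Let $V:(0,\infty)\to[0,\infty)$ be measurable with $V\in L^1_{\mathrm{loc}}((0,\infty))$, and let $K:(0,\infty)\to(0,\infty)$ be measurable with $K\in L^s_{\mathrm{loc}}((0,\infty))$ for some $s>1$. Let $S_A$ be the set of radial functions $u\in C_c^\infty(\mathbb R^N)$ with $\|u\|_A:=\big(\int_{\mathbb R^N}A(|x|)|\nabla u|^p\,dx\big)^{1/p}<\infty$, let $D_A$ be the completion of $S_A$ with respect to $\|\cdot\|_A$ (realized as a space of functions, each element being the almost everywhere limit of the $\|\cdot\|_A$-Cauchy sequences in $S_A$ that define it, with norm again denoted by $\|\cdot\|_A$), and let $$X:=D_A\cap L^p(\mathbb R^N,V(|x|)\,dx),\qquad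 \|u\|:=\Big(\|u\|_A^p+\int_{\mathbb R^N}V(|x|)|u|^p\,dx\Big)^{1/p}.$$ For $q>1$ and $R>0$ put $$\mathcal S_\infty(q,R):=\sup_{u\in X,\ \|u\|=1}\int_{\mathbb R^N\setminus B_R}K(|x|)|u|^q\,dx\in[0,\infty],\qquad B_R:=\{x\in\mathbb R^N:|x|<R\}.$$ **Theorem 3.2.** Assume that there exists $R_2>0$ such that $$\operatorname*{ess\,sup}_{r>R_2}\frac{K(r)}{r^{\alpha_\infty}V(r)^{\beta_\infty}}<+\infty\quad\text{for some }0\le\beta_\infty\le1\text{ and }\alpha_\infty\in\mathbb R$$ (with $V(r)^0=1$ for every $r$, even if $V(r)=0$) and $$\operatorname*{ess\,inf}_{r>R_2}r^{\gamma_\infty}V(r)>0\quad\text{for some real }\gamma_\infty\le p-a_\infty .$$ Then $\lim_{R\to+\infty}\mathcal S_\infty(q_2,R)=0$ for every $q_2\in\mathbb R$ with $q_2>\max\{1,p\beta_\infty,q_*,q_{**}\}$, where $$q_*:=p\,\frac{\alpha_\infty-\gamma_\infty\beta_\infty+N}{N-\gamma_\infty},\qquad q_{**}:=p\,\frac{p\alpha_\infty+(1-p\beta_\infty)\gamma_\infty+p(N-1)+a_\infty}{p(N-1)-\gamma_\infty(p-1)+a_\infty}.$$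 (Both denominators are positive because $\gamma_\infty\le p-a_\infty$ and $a_\infty>p-N$.) -/

import Mathlib

open MeasureTheory Filter Topology Set
open scoped ENNReal ContDiff

noncomputable section

namespace RadialEmbedding

/-- `ℝ^N` with its Euclidean norm. -/
abbrev E (N : ℕ) : Type := EuclideanSpace ℝ (Fin N)

/-- Hypothesis (A): `A` is continuous and positive on `(0,∞)`, and comparable to `r ^ a₀` near `0`
and to `r ^ a∞` near `∞`, with `a₀, a∞ ∈ (p - N, p]`. The lower and upper limits are taken in
`[0,∞]`. Values of `A` outside `(0,∞)` play no role. -/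
structure HypA (N : ℕ) (p a₀ aInf : ℝ) (A : ℝ → ℝ) : Prop where
  continuousOn : ContinuousOn A (Ioi 0)
  pos : ∀ r, 0 < r → 0 < A r
  a₀_mem : a₀ ∈ Ioc (p - N) p
  aInf_mem : aInf ∈ Ioc (p - N) p
  liminf_zero : ∃ c₀ : ℝ, 0 < c₀ ∧
    ENNReal.ofReal c₀ ≤ liminf (fun r => ENNReal.ofReal (A r / r ^ a₀)) (𝓝[>] 0)
  limsup_zero : limsup (fun r => ENNReal.ofReal (A r / r ^ a₀)) (𝓝[>] 0) < ⊤
  liminf_top : ∃ cInf : ℝ, 0 < cInf ∧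
    ENNReal.ofReal cInf ≤ liminf (fun r => ENNReal.ofReal (A r / r ^ aInf)) atTop
  limsup_top : limsup (fun r => ENNReal.ofReal (A r / r ^ aInf)) atTop < ⊤

/-- Hypothesis (V): `V ≥ 0` is a (Lebesgue) measurable function in `L¹_loc((0,∞))`. -/
structure HypV (V : ℝ → ℝ) : Prop where
  nonneg : ∀ r, 0 < r → 0 ≤ V r
  aemeasurable : AEMeasurable V (volume.restrict (Ioi 0))
  locallyIntegrableOn : LocallyIntegrableOn V (Ioi 0)

/-- Hypothesis (K): `K > 0` is a (Lebesgue) measurable function in `L^s_loc((0,∞))` for some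
`s > 1`. -/
structure HypK (K : ℝ → ℝ) : Prop where
  pos : ∀ r, 0 < r → 0 < K r
  aemeasurable : AEMeasurable K (volume.restrict (Ioi 0))
  locallyIntegrableOn : ∃ s : ℝ, 1 < s ∧ LocallyIntegrableOn (fun r => K r ^ s) (Ioi 0)

/-- `‖φ‖_A = (∫ A(|x|) |∇φ|^p dx)^{1/p}` for a smooth function `φ`, as an element of `[0,∞]`. -/
def normA {N : ℕ} (p : ℝ) (A : ℝ → ℝ) (φ : E N → ℝ) : ℝ≥0∞ :=
  (∫⁻ x, ENNReal.ofReal (A ‖x‖) * ‖gradient φ x‖ₑ ^ p) ^ (1 / p)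

/-- `S_A`: the radial functions in `C_c^∞(ℝ^N)` with `‖φ‖_A < ∞`. -/
structure MemSA {N : ℕ} (p : ℝ) (A : ℝ → ℝ) (φ : E N → ℝ) : Prop where
  contDiff : ContDiff ℝ ∞ φ
  hasCompactSupport : HasCompactSupport φ
  radial : ∀ x y, ‖x‖ = ‖y‖ → φ x = φ y
  finite : normA p A φ < ⊤

/-- `φ` is a Cauchy sequence in `(S_A, ‖·‖_A)` and the function `u` is its almost everywhere
limit, i.e. `u` is the function representing the element of the completion of `S_A` that is
defined by `φ`. -/
structure Represents {N : ℕ} (p : ℝ) (A : ℝ → ℝ) (φ : ℕ → E N → ℝ) (u : E N → ℝ) : Prop where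
  mem : ∀ n, MemSA p A (φ n)
  cauchy : ∀ ε : ℝ≥0∞, 0 < ε → ∃ n₀, ∀ m ≥ n₀, ∀ n ≥ n₀, normA p A (φ m - φ n) ≤ ε
  tendsto : ∀ᵐ x, Tendsto (fun n => φ n x) atTop (𝓝 (u x))

/-- `D_A`, the completion of `S_A` with respect to `‖·‖_A`, realized as a space of functions:
the almost everywhere limits of the `‖·‖_A`-Cauchy sequences of `S_A`. -/
def MemDA {N : ℕ} (p : ℝ) (A : ℝ → ℝ) (u : E N → ℝ) : Prop :=
  ∃ φ, Represents p A φ u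

/-- The norm of the completion `D_A`: the limit of `‖φ_n‖_A` along a Cauchy sequence `φ`
representing `u`. (Under hypothesis (A), any two Cauchy sequences with the same almost everywhere
limit are equivalent, hence there is only one such limit for `u ∈ D_A`; the infimum selects it.
For `u ∉ D_A` the value is `∞`.) -/
def normDA {N : ℕ} (p : ℝ) (A : ℝ → ℝ) (u : E N → ℝ) : ℝ≥0∞ :=
  sInf {l | ∃ φ, Represents p A φ u ∧ Tendsto (fun n => normA p A (φ n)) atTop (𝓝 l)}

/-- `‖u‖^p` in `L^p(ℝ^N, V(|x|) dx)`, as an element of `[0,∞]`. -/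
def normLVPow {N : ℕ} (p : ℝ) (V : ℝ → ℝ) (u : E N → ℝ) : ℝ≥0∞ :=
  ∫⁻ x, ENNReal.ofReal (V ‖x‖) * ‖u x‖ₑ ^ p

/-- `X = D_A ∩ L^p(ℝ^N, V(|x|) dx)`. Measurability of `u ∈ D_A` is automatic, as `u` is an
almost everywhere limit of smooth functions. -/
def MemX {N : ℕ} (p : ℝ) (A V : ℝ → ℝ) (u : E N → ℝ) : Prop :=
  MemDA p A u ∧ normLVPow p V u < ⊤

/-- The norm of `X`: `(‖u‖_A^p + ‖u‖_{L^p(V dx)}^p)^{1/p}`. -/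
def normX {N : ℕ} (p : ℝ) (A V : ℝ → ℝ) (u : E N → ℝ) : ℝ≥0∞ :=
  (normDA p A u ^ p + normLVPow p V u) ^ (1 / p)

/-- `S_∞(q,R)`: the supremum of `∫_{ℝ^N ∖ B_R} K(|x|) |u|^q dx` over `u ∈ X` with `‖u‖ = 1`;
it may be `∞`. -/
def supInfty (N : ℕ) (p : ℝ) (A V K : ℝ → ℝ) (q R : ℝ) : ℝ≥0∞ :=
  ⨆ (u : E N → ℝ) (_ : MemX p A V u) (_ : normX p A V u = 1),
    ∫⁻ x in (Metric.ball (0 : E N) R)ᶜ, ENNReal.ofReal (K ‖x‖) * ‖u x‖ₑ ^ q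

/-- The exponent `q_*`. -/
def qStar (N : ℕ) (p α β γ : ℝ) : ℝ :=
  p * ((α - γ * β + N) / (N - γ))

/-- The exponent `q_**`. -/
def qStarStar (N : ℕ) (p a α β γ : ℝ) : ℝ :=
  p * ((p * α + (1 - p * β) * γ + p * (N - 1) + a) / (p * (N - 1) - γ * (p - 1) + a))

end RadialEmbedding

end

noncomputable section

namespace RadialEmbedding

/-! On the unit sphere of `X` the lower bound on `V` at infinity yields `|x|^(-γ) ≤ M V`, so that
the part of `∫ |u|^p |x|^(-γ)` far from the origin is bounded. The argument splits at `q₂ = p`. If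
`q₂ ≥ p`, integrating the radial derivative of `|u|^p` from infinity and applying Hölder with the
weights `|x|^a` and `|x|^(-γ)` (`enorm_rpow_le_add`) gives the uniform decay `|u|^p ≤ D |x|^(-κ)`,
`κ = N - 1 + a/p - γ(1 - 1/p)` (`exists_ae_rpow_le`). Decay absorbs `|u|^(q₂-p)` and the lower bound
turns `V^β` into `V`, so the integral off `B_R` is at most a constant times `R^θ ∫ V|u|^p`; the
condition `θ < 0` is exactly `q₂ > q_**` (`tendsto_supInfty_of_le`). If `q₂ < p`, no pointwise decay
is needed: `V^β` is raised to `V^(q₂/p)` and Hölder leaves the tail of a power `|x|^b`, with `b <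
-N` exactly when `q₂ > q_*` (`tendsto_supInfty_of_lt`). The delicate point is that a sequence
defining `u` converges only in `‖·‖_A` and almost everywhere, not in `L^p(V)`. The estimate is
therefore made on bounded shells, where the cruder decay coming from `‖·‖_A` alone
(`enorm_le_decayFactor_mul`) allows dominated convergence; the outer radius is sent to infinity
last. -/

/-! ### Polar coordinates and calculus along rays. -/

/-- The surface measure of the unit sphere of `ℝ^N`. -/
def sphereMass (N : ℕ) : ℝ≥0∞ := (volume : Measure (E N)).toSphere univ

lemma sphereMass_ne_top (N : ℕ) : sphereMass N ≠ ⊤ := measure_ne_top _ _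

lemma sphereMass_ne_zero {N : ℕ} (hN : 0 < N) : sphereMass N ≠ 0 := by
  have : Nonempty (Fin N) := ⟨⟨0, hN⟩⟩
  unfold sphereMass
  rw [Ne, Measure.measure_univ_eq_zero]
  exact Measure.toSphere_ne_zero _

lemma lintegral_fun_norm {N : ℕ} (hN : 0 < N) {g : ℝ → ℝ≥0∞} (hg : Measurable g) :
    ∫⁻ x : E N, g ‖x‖ =
      sphereMass N * ∫⁻ r in Ioi (0 : ℝ), ENNReal.ofReal (r ^ (N - 1)) * g r := by
  have : Nonempty (Fin N) := ⟨⟨0, hN⟩⟩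
  have hd : Module.finrank ℝ (E N) = N := by simp
  calc
    ∫⁻ x : E N, g ‖x‖
        = ∫⁻ x : ({(0)}ᶜ : Set (E N)), g ‖x.1‖ ∂((volume : Measure (E N)).comap (↑)) := by
      rw [lintegral_subtype_comap (measurableSet_singleton _).compl fun x ↦ g ‖x‖,
        restrict_compl_singleton]
    _ = ∫⁻ x, g x.2 ∂(volume : Measure (E N)).toSphere.prod (.volumeIoiPow (N - 1)) := by
      have := (volume : Measure (E N)).measurePreserving_homeomorphUnitSphereProd
      rw [hd] at this
      simpa using this.lintegral_comp_emb
        (Homeomorph.measurableEmbedding _) (fun y => g y.2)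
    _ = sphereMass N * ∫⁻ x : Ioi (0 : ℝ), g x ∂.volumeIoiPow (N - 1) := by
      rw [lintegral_prod _ (by fun_prop)]
      simp [sphereMass, mul_comm]
    _ = _ := by
      congr 1
      rw [Measure.volumeIoiPow, lintegral_withDensity_eq_lintegral_mul _ (by fun_prop)
        (by fun_prop)]
      exact lintegral_subtype_comap measurableSet_Ioi
        (fun r : ℝ => ENNReal.ofReal (r ^ (N - 1)) * g r)

/-- Polar coordinates send null sets of radii to null sets of points. This carries almost everywhere
bounds on `K` and `V`, and the measurability of `V`, from the half-line to `ℝ^N`. -/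
lemma quasiMeasurePreserving_norm {N : ℕ} (hN : 0 < N) :
    Measure.QuasiMeasurePreserving (fun x : E N => ‖x‖) volume
      (volume.restrict (Ioi (0 : ℝ))) := by
  refine ⟨measurable_norm, ?_⟩
  refine Measure.AbsolutelyContinuous.mk fun s hs h0 => ?_
  rw [Measure.map_apply measurable_norm hs, ← lintegral_indicator_one (measurable_norm hs)]
  have := lintegral_fun_norm hN (g := s.indicator 1) (measurable_one.indicator hs)
  have h1 : ∀ x : E N, ((fun x : E N => ‖x‖) ⁻¹' s).indicator (1 : E N → ℝ≥0∞) x =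
      s.indicator 1 ‖x‖ := fun x => rfl
  simp_rw [h1]
  rw [this]
  have h2 : ∀ᵐ r ∂(volume.restrict (Ioi (0 : ℝ))), r ∉ s := by
    rw [ae_iff]; simpa using h0
  have h3 : ∫⁻ r in Ioi (0 : ℝ), ENNReal.ofReal (r ^ (N - 1)) * s.indicator 1 r = 0 := by
    rw [lintegral_eq_zero_iff' (by fun_prop (disch := assumption))]
    filter_upwards [h2] with r hr
    simp [hr]
  rw [h3, mul_zero]

lemma ae_norm_of_ae {N : ℕ} (hN : 0 < N) {R : ℝ} {P : ℝ → Prop}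
    (h : ∀ᵐ r ∂(volume.restrict (Ioi R)), P r) : ∀ᵐ x : E N, R < ‖x‖ → P ‖x‖ := by
  rw [ae_restrict_iff' measurableSet_Ioi] at h
  exact (quasiMeasurePreserving_norm hN).ae (ae_restrict_of_ae h)

/-- Euclidean form of a one-dimensional integral. -/
lemma lintegral_Ioc_eq {N : ℕ} (hN : 0 < N) {r R : ℝ} (hr : 0 < r) {h : ℝ → ℝ≥0∞}
    (hh : Measurable h) :
    ∫⁻ s in Ioc r R, h s = (sphereMass N)⁻¹ *
      ∫⁻ x in {x : E N | ‖x‖ ∈ Ioc r R}, h ‖x‖ * ‖x‖ₑ ^ (-((N : ℝ) - 1)) := by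
  set g : ℝ → ℝ≥0∞ := (Ioc r R).indicator
    (fun s => h s * ENNReal.ofReal s ^ (-((N : ℝ) - 1))) with hg
  have hgm : Measurable g := by
    refine Measurable.indicator ?_ measurableSet_Ioc
    fun_prop
  have hS : MeasurableSet {x : E N | ‖x‖ ∈ Ioc r R} := measurable_norm measurableSet_Ioc
  have h1 : ∫⁻ x in {x : E N | ‖x‖ ∈ Ioc r R}, h ‖x‖ * ‖x‖ₑ ^ (-((N : ℝ) - 1)) =
      ∫⁻ x : E N, g ‖x‖ := by
    rw [← lintegral_indicator hS]
    refine lintegral_congr fun x => ?_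
    by_cases hx : ‖x‖ ∈ Ioc r R
    · rw [indicator_of_mem (by exact hx), hg, indicator_of_mem hx, ofReal_norm]
    · rw [indicator_of_notMem (by exact hx), hg, indicator_of_notMem hx]
  rw [h1, lintegral_fun_norm hN hgm, ← mul_assoc,
    ENNReal.inv_mul_cancel (sphereMass_ne_zero hN) (sphereMass_ne_top N), one_mul,
    ← lintegral_indicator measurableSet_Ioc, ← lintegral_indicator measurableSet_Ioi]
  refine lintegral_congr fun s => ?_
  by_cases hs : s ∈ Ioc r R
  · have hs0 : 0 < s := hr.trans hs.1
    have hs' : ENNReal.ofReal s ≠ 0 := by simpa using hs0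
    rw [indicator_of_mem hs, indicator_of_mem (by exact hs0), hg, indicator_of_mem hs,
      ENNReal.ofReal_pow hs0.le, ← ENNReal.rpow_natCast, mul_left_comm,
      ← ENNReal.rpow_add _ _ hs' ENNReal.ofReal_ne_top, Nat.cast_sub hN]
    simp
  · by_cases hs0 : 0 < s
    · rw [indicator_of_notMem hs, indicator_of_mem (by exact hs0), hg, indicator_of_notMem hs,
        mul_zero]
    · rw [indicator_of_notMem hs, indicator_of_notMem (by exact hs0)]

/-- Fundamental theorem of calculus along rays for radial functions. -/
lemma radial_ftc {N : ℕ} (hN : 0 < N) {Φ : E N → ℝ} (hΦ : ContDiff ℝ 1 Φ)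
    (hrad : ∀ x y, ‖x‖ = ‖y‖ → Φ x = Φ y) {x₀ x₁ : E N} (h0 : 0 < ‖x₀‖) (h01 : ‖x₀‖ ≤ ‖x₁‖) :
    ‖Φ x₀‖ₑ ≤ ‖Φ x₁‖ₑ + (sphereMass N)⁻¹ *
      ∫⁻ x in {x : E N | ‖x‖ ∈ Ioc ‖x₀‖ ‖x₁‖}, ‖fderiv ℝ Φ x‖ₑ * ‖x‖ₑ ^ (-((N : ℝ) - 1)) := by
  set e : E N := ‖x₀‖⁻¹ • x₀ with he
  have hen : ‖e‖ = 1 := by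
    rw [he, norm_smul, norm_inv, norm_norm, inv_mul_cancel₀ h0.ne']
  set f : ℝ → ℝ := fun s => Φ (s • e) with hf
  have hray : ∀ (v : E N) (s : ℝ), HasDerivAt (fun s : ℝ => Φ (s • v))
      (fderiv ℝ Φ (s • v) v) s := fun v s => by
    have h1 : HasDerivAt (fun s : ℝ => s • v) v s := by
      simpa using (hasDerivAt_id s).smul_const v
    exact ((hΦ.differentiable one_ne_zero).differentiableAt.hasFDerivAt).comp_hasDerivAt s h1
  set f' : ℝ → ℝ := fun s => fderiv ℝ Φ (s • e) e with hf'
  have hf'c : Continuous f' := by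
    have := hΦ.continuous_fderiv one_ne_zero
    have h2 : Continuous fun s : ℝ => fderiv ℝ Φ (s • e) := this.comp (by fun_prop)
    exact h2.clm_apply continuous_const
  have hfn : ∀ x : E N, f ‖x‖ = Φ x := fun x => hrad _ _ (by simp [norm_smul, hen])
  -- The profile `f` does not depend on the direction of the ray. At `x` it may be computed along
  -- the ray through `x`, where its derivative is a directional derivative of `Φ` at `x` itself.
  have hle : ∀ x : E N, 0 < ‖x‖ → ‖f' ‖x‖‖ₑ ≤ ‖fderiv ℝ Φ x‖ₑ := by
    intro x hx
    set v : E N := ‖x‖⁻¹ • x with hv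
    have hvn : ‖v‖ = 1 := by
      rw [hv, norm_smul, norm_inv, norm_norm, inv_mul_cancel₀ hx.ne']
    have hfv : f = fun s : ℝ => Φ (s • v) := by
      funext s
      exact hrad _ _ (by simp [norm_smul, hen, hvn])
    have h1 := hray e ‖x‖
    have h2 := hray v ‖x‖
    rw [← hfv] at h2
    have h3 : f' ‖x‖ = fderiv ℝ Φ (‖x‖ • v) v := h1.unique h2
    have h4 : ‖x‖ • v = x := by rw [hv, smul_smul, mul_inv_cancel₀ hx.ne', one_smul]
    rw [h3, h4]
    have := (fderiv ℝ Φ x).le_opENorm v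
    have hve : ‖v‖ₑ = 1 := by rw [← ofReal_norm, hvn, ENNReal.ofReal_one]
    rwa [hve, mul_one] at this
  have hint : ∫ s in ‖x₀‖..‖x₁‖, f' s = Φ x₁ - Φ x₀ := by
    rw [intervalIntegral.integral_eq_sub_of_hasDerivAt (f := f) (fun s _ => hray e s)
      (hf'c.intervalIntegrable _ _), hfn, hfn]
  have h5 : ‖Φ x₁ - Φ x₀‖ₑ ≤ ∫⁻ s in Ioc ‖x₀‖ ‖x₁‖, ‖f' s‖ₑ := by
    rw [← hint, intervalIntegral.integral_of_le h01]
    exact enorm_integral_le_lintegral_enorm _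
  have h6 : ‖Φ x₀‖ₑ ≤ ‖Φ x₁‖ₑ + ‖Φ x₁ - Φ x₀‖ₑ := by
    have : Φ x₀ = Φ x₁ - (Φ x₁ - Φ x₀) := by ring
    conv_lhs => rw [this]
    exact enorm_sub_le
  refine h6.trans ?_
  gcongr
  refine h5.trans ?_
  rw [lintegral_Ioc_eq hN h0 hf'c.enorm.measurable]
  gcongr _ * ?_
  have hS : MeasurableSet {x : E N | ‖x‖ ∈ Ioc ‖x₀‖ ‖x₁‖} := measurable_norm measurableSet_Ioc
  refine setLIntegral_mono' hS fun x hx => ?_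
  gcongr
  exact hle x (h0.trans hx.1)

/-! ### Powers of the norm at infinity. -/

lemma enorm_ne_zero_of_norm_pos {N : ℕ} {x : E N} (hx : 0 < ‖x‖) : ‖x‖ₑ ≠ 0 := by
  simpa using hx

lemma tendsto_ofReal_rpow_nhds_zero {b : ℝ} (hb : b < 0) :
    Tendsto (fun R : ℝ => ENNReal.ofReal R ^ b) atTop (𝓝 0) := by
  have h1 : Tendsto (fun R : ℝ => ENNReal.ofReal (R ^ b)) atTop (𝓝 0) := by
    have := ENNReal.tendsto_ofReal (tendsto_rpow_neg_atTop (neg_pos.2 hb))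
    simpa using this
  refine h1.congr' ?_
  filter_upwards [eventually_gt_atTop 0] with R hR
  rw [ENNReal.ofReal_rpow_of_pos hR]

/-- Tails of integrable powers. -/
lemma tendsto_tail {N : ℕ} {b : ℝ} (hb : b < -N) :
    Tendsto (fun R : ℝ => ∫⁻ x in (Metric.ball (0 : E N) R)ᶜ, ‖x‖ₑ ^ b) atTop (𝓝 0) := by
  -- Half of the gap between `b` and `-N` gives the rate `R^(-δ)`; the other half keeps `r = -(b +
  -- δ)` above `N`, so that `(1 + |x|)^(-r)` is integrable.
  set δ : ℝ := (-N - b) / 2 with hδ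
  have hδ0 : 0 < δ := by rw [hδ]; linarith
  set r : ℝ := -(b + δ) with hr
  have hrN : (N : ℝ) < r := by rw [hr, hδ]; linarith
  clear_value r
  have hr0 : 0 < r := lt_of_le_of_lt (Nat.cast_nonneg N) hrN
  set J : ℝ≥0∞ := ∫⁻ x : E N, ENNReal.ofReal ((1 + ‖x‖) ^ (-r)) with hJ
  have hJt : J < ⊤ := finite_integral_one_add_norm (by simpa using hrN)
  have hub : ∀ᶠ R : ℝ in atTop, ∫⁻ x in (Metric.ball (0 : E N) R)ᶜ, ‖x‖ₑ ^ b ≤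
      ENNReal.ofReal R ^ (-δ) * (2 ^ r * J) := by
    filter_upwards [eventually_ge_atTop 1] with R hR
    calc ∫⁻ x in (Metric.ball (0 : E N) R)ᶜ, ‖x‖ₑ ^ b
        ≤ ∫⁻ x in (Metric.ball (0 : E N) R)ᶜ, ENNReal.ofReal R ^ (-δ) *
            (2 ^ r * ENNReal.ofReal ((1 + ‖x‖) ^ (-r))) := by
          refine setLIntegral_mono' Metric.isOpen_ball.measurableSet.compl fun x hx => ?_
          have hxR : R ≤ ‖x‖ := by simpa using hx
          have hx0 : 0 < ‖x‖ := by linarith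
          have e1 : ‖x‖ₑ ^ b = ‖x‖ₑ ^ (-δ) * ‖x‖ₑ ^ (-r) := by
            rw [← ENNReal.rpow_add _ _ (enorm_ne_zero_of_norm_pos hx0) (by simp)]
            congr 1; rw [hr]; ring
          rw [e1]
          gcongr ?_ * ?_
          · rw [ENNReal.rpow_neg, ENNReal.rpow_neg, ENNReal.inv_le_inv, ← ofReal_norm]
            gcongr
          · have e2 : ENNReal.ofReal ((1 + ‖x‖) ^ (-r)) = (1 + ‖x‖ₑ) ^ (-r) := by
              rw [← ENNReal.ofReal_rpow_of_pos (by linarith), ENNReal.ofReal_add (by norm_num)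
                (norm_nonneg _), ofReal_norm, ENNReal.ofReal_one]
            have e3 : (1 + ‖x‖ₑ) ≤ 2 * ‖x‖ₑ := by
              rw [two_mul]
              gcongr
              rw [← ofReal_norm, ENNReal.one_le_ofReal]; linarith
            have e4 : ‖x‖ₑ ^ (-r) = 2 ^ r * (2 * ‖x‖ₑ) ^ (-r) := by
              rw [ENNReal.mul_rpow_of_ne_zero two_ne_zero (enorm_ne_zero_of_norm_pos hx0),
                ← mul_assoc, ← ENNReal.rpow_add _ _ two_ne_zero ENNReal.ofNat_ne_top,
                add_neg_cancel, ENNReal.rpow_zero, one_mul]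
            rw [e2, e4]
            gcongr _ * ?_
            rw [ENNReal.rpow_neg, ENNReal.rpow_neg, ENNReal.inv_le_inv]
            gcongr
      _ ≤ ∫⁻ x : E N, ENNReal.ofReal R ^ (-δ) *
            (2 ^ r * ENNReal.ofReal ((1 + ‖x‖) ^ (-r))) := setLIntegral_le_lintegral _ _
      _ = _ := by
          have hm : Measurable fun x : E N => ENNReal.ofReal ((1 + ‖x‖) ^ (-r)) := by fun_prop
          rw [lintegral_const_mul _ (by fun_prop), lintegral_const_mul _ hm]
  have h0 := ENNReal.Tendsto.mul_const (b := 2 ^ r * J)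
    (tendsto_ofReal_rpow_nhds_zero (neg_lt_zero.2 hδ0)) (Or.inr (by
      exact ENNReal.mul_ne_top (by simp) hJt.ne))
  rw [zero_mul] at h0
  exact tendsto_of_tendsto_of_tendsto_of_le_of_le' tendsto_const_nhds h0
    (Eventually.of_forall fun _ => zero_le) hub

/-! ### The hypotheses at infinity as multiplicative bounds. -/

lemma HypA.exists_rpow_le {N : ℕ} {p a₀ a : ℝ} {A : ℝ → ℝ} (hA : HypA N p a₀ a A) :
    ∃ C : ℝ≥0∞, C ≠ ⊤ ∧ ∃ R > 0, ∀ r ≥ R, ENNReal.ofReal r ^ a ≤ C * ENNReal.ofReal (A r) := by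
  obtain ⟨c, hc, hcl⟩ := hA.liminf_top
  have h1 : ENNReal.ofReal (c / 2) <
      liminf (fun r => ENNReal.ofReal (A r / r ^ a)) atTop := by
    refine lt_of_lt_of_le ?_ hcl
    rw [ENNReal.ofReal_lt_ofReal_iff hc]
    linarith
  obtain ⟨R, hR⟩ := eventually_atTop.1 (eventually_lt_of_lt_liminf h1)
  refine ⟨ENNReal.ofReal (2 / c), ENNReal.ofReal_ne_top, max R 1, by positivity, fun r hr => ?_⟩
  have hr0 : 0 < r := lt_of_lt_of_le one_pos ((le_max_right _ _).trans hr)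
  have hra : 0 < r ^ a := Real.rpow_pos_of_pos hr0 a
  have h2 := hR r ((le_max_left _ _).trans hr)
  have h3 : c / 2 < A r / r ^ a := ENNReal.ofReal_lt_ofReal_iff'.1 h2 |>.1
  rw [lt_div_iff₀ hra] at h3
  rw [ENNReal.ofReal_rpow_of_pos hr0, ← ENNReal.ofReal_mul (by positivity)]
  refine ENNReal.ofReal_le_ofReal ?_
  have : r ^ a = 2 / c * (c / 2 * r ^ a) := by field_simp
  rw [this]
  gcongr

lemma exists_ae_le_of_essSup_lt_top {K V : ℝ → ℝ} {R α β : ℝ} (hR : 0 < R) (hβ : 0 ≤ β)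
    (hV : ∀ r, 0 < r → 0 ≤ V r)
    (h : essSup (fun r : ℝ => ENNReal.ofReal (K r) / ENNReal.ofReal (r ^ α * V r ^ β))
      (volume.restrict (Ioi R)) < ⊤) :
    ∃ M : ℝ≥0∞, M ≠ ⊤ ∧ ∀ᵐ r ∂(volume.restrict (Ioi R)),
      ENNReal.ofReal (K r) ≤ M * (ENNReal.ofReal r ^ α * ENNReal.ofReal (V r) ^ β) := by
  refine ⟨_, h.ne, ?_⟩
  filter_upwards [ENNReal.ae_le_essSup (μ := volume.restrict (Ioi R))
    (fun r : ℝ => ENNReal.ofReal (K r) / ENNReal.ofReal (r ^ α * V r ^ β)),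
    ae_restrict_mem measurableSet_Ioi] with r hr hrR
  have hr0 : 0 < r := hR.trans hrR
  set M := essSup (fun r : ℝ => ENNReal.ofReal (K r) / ENNReal.ofReal (r ^ α * V r ^ β))
      (volume.restrict (Ioi R)) with hM
  have e : ENNReal.ofReal r ^ α * ENNReal.ofReal (V r) ^ β =
      ENNReal.ofReal (r ^ α * V r ^ β) := by
    rw [ENNReal.ofReal_rpow_of_pos hr0, ENNReal.ofReal_rpow_of_nonneg (hV r hr0) hβ,
      ENNReal.ofReal_mul (Real.rpow_nonneg hr0.le _)]
  rw [e]
  -- Where the denominator vanishes, a nonzero numerator gives the quotient `⊤`, which the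
  -- finiteness of `M` excludes.
  refine (ENNReal.div_le_iff_le_mul (Or.inr h.ne) (Or.inl ENNReal.ofReal_ne_top)).1 ?_ 
  exact hr

lemma exists_ae_rpow_le_of_essInf_pos {V : ℝ → ℝ} {R γ : ℝ} (hR : 0 < R)
    (h : 0 < essInf (fun r : ℝ => ENNReal.ofReal (r ^ γ * V r)) (volume.restrict (Ioi R))) :
    ∃ M : ℝ≥0∞, M ≠ ⊤ ∧ ∀ᵐ r ∂(volume.restrict (Ioi R)),
      ENNReal.ofReal r ^ (-γ) ≤ M * ENNReal.ofReal (V r) := by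
  set c := essInf (fun r : ℝ => ENNReal.ofReal (r ^ γ * V r)) (volume.restrict (Ioi R)) with hc
  refine ⟨c⁻¹, ENNReal.inv_ne_top.2 h.ne', ?_⟩
  filter_upwards [ae_essInf_le (μ := volume.restrict (Ioi R))
    (f := fun r : ℝ => ENNReal.ofReal (r ^ γ * V r)),
    ae_restrict_mem measurableSet_Ioi] with r hr hrR
  have hr0 : 0 < r := hR.trans hrR
  have hrg : 0 < r ^ γ := Real.rpow_pos_of_pos hr0 γ
  rw [← hc] at hr
  have hct : c ≠ ⊤ := ne_top_of_le_ne_top ENNReal.ofReal_ne_top hr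
  rw [ENNReal.ofReal_mul hrg.le, ← ENNReal.ofReal_rpow_of_pos hr0] at hr
  have h0 : ENNReal.ofReal r ≠ 0 := by simpa using hr0
  calc ENNReal.ofReal r ^ (-γ) = c⁻¹ * (c * ENNReal.ofReal r ^ (-γ)) := by
        rw [← mul_assoc, ENNReal.inv_mul_cancel h.ne' hct, one_mul]
    _ ≤ c⁻¹ * (ENNReal.ofReal r ^ γ * ENNReal.ofReal (V r) * ENNReal.ofReal r ^ (-γ)) := by
        gcongr
    _ = c⁻¹ * ENNReal.ofReal (V r) := by
        rw [mul_right_comm, ← ENNReal.rpow_add _ _ h0 ENNReal.ofReal_ne_top, add_neg_cancel,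
          ENNReal.rpow_zero, one_mul]

/-! ### Pointwise estimates for functions in `S_A`. -/

lemma enorm_gradient {N : ℕ} (φ : E N → ℝ) (x : E N) : ‖gradient φ x‖ₑ = ‖fderiv ℝ φ x‖ₑ := by
  rw [gradient, ← ofReal_norm, LinearIsometryEquiv.norm_map, ofReal_norm]

lemma norm_le_of_mem_compl_ball {N : ℕ} {x : E N} {r : ℝ}
    (hx : x ∈ (Metric.ball (0 : E N) r)ᶜ) : r ≤ ‖x‖ := by
  simpa using hx

lemma measurableSet_compl_ball {N : ℕ} (r : ℝ) :
    MeasurableSet (Metric.ball (0 : E N) r)ᶜ :=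
  Metric.isOpen_ball.measurableSet.compl

lemma lintegral_fderiv_le {N : ℕ} {p a : ℝ} (hp : 0 < p) {A : ℝ → ℝ} {C : ℝ≥0∞} (hC : C ≠ ⊤)
    {R : ℝ} (hA : ∀ r ≥ R, ENNReal.ofReal r ^ a ≤ C * ENNReal.ofReal (A r)) (φ : E N → ℝ) :
    (∫⁻ x in (Metric.ball (0 : E N) R)ᶜ, ‖fderiv ℝ φ x‖ₑ ^ p * ‖x‖ₑ ^ a) ^ (1 / p) ≤
      C ^ (1 / p) * normA p A φ := by
  rw [normA, ← ENNReal.mul_rpow_of_nonneg _ _ (by positivity)]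
  gcongr
  rw [← lintegral_const_mul' _ _ hC]
  refine le_trans (setLIntegral_mono' (measurableSet_compl_ball R) fun x hx => ?_)
    (setLIntegral_le_lintegral _ _)
  rw [enorm_gradient, mul_comm, ← mul_assoc, ← ofReal_norm]
  gcongr
  exact hA _ (norm_le_of_mem_compl_ball hx)

/-- The factor in the uniform decay estimate. -/
def decayFactor (N : ℕ) (p a : ℝ) (C : ℝ≥0∞) (r : ℝ) : ℝ≥0∞ :=
  (sphereMass N)⁻¹ * (C ^ (1 / p) *
    (∫⁻ x in (Metric.ball (0 : E N) r)ᶜ, ‖x‖ₑ ^ (-(((N : ℝ) - 1) * p + a) / (p - 1))) ^ (1 - 1 / p))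

lemma decayFactor_anti {N : ℕ} {p a : ℝ} (hp : 1 < p) (C : ℝ≥0∞) :
    Antitone (decayFactor N p a C) := by
  intro r s hrs
  have : 0 ≤ 1 - 1 / p := by
    rw [sub_nonneg, div_le_one (by linarith)]; exact hp.le
  unfold decayFactor
  gcongr

lemma tendsto_decayFactor {N : ℕ} (hN : 0 < N) {p a : ℝ} (hp : 1 < p) (ha : p - N < a)
    {C : ℝ≥0∞} (hC : C ≠ ⊤) : Tendsto (decayFactor N p a C) atTop (𝓝 0) := by
  have h1 : 0 < 1 - 1 / p := by
    rw [sub_pos, div_lt_one (by linarith)]; exact hp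
  -- Multiplied by `p - 1`, this is `p - N < a`: the dual weight in Hölder's inequality is
  -- integrable at infinity.
  have hb : -(((N : ℝ) - 1) * p + a) / (p - 1) < -N := by
    rw [div_lt_iff₀ (by linarith)]
    nlinarith
  have h2 := (tendsto_tail hb).ennrpow_const (1 - 1 / p)
  rw [ENNReal.zero_rpow_of_pos h1] at h2
  have h3 := ENNReal.Tendsto.const_mul h2 (a := C ^ (1 / p))
    (Or.inr (ENNReal.rpow_ne_top_of_nonneg (by positivity) hC))
  have h4 := ENNReal.Tendsto.const_mul h3 (a := (sphereMass N)⁻¹)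
    (Or.inr (ENNReal.inv_ne_top.2 (sphereMass_ne_zero hN)))
  rw [mul_zero, mul_zero] at h4
  exact h4

/-- Integrate the radial derivative out to a zero of `φ` and apply Hölder with weight `|x|^a`. Since
`V` does not enter, the bound is uniform along a Cauchy sequence in `S_A`. -/
lemma enorm_le_decayFactor_mul {N : ℕ} (hN : 0 < N) {p a : ℝ} (hp : 1 < p) {A : ℝ → ℝ}
    {C : ℝ≥0∞} (hC : C ≠ ⊤) {R : ℝ} (hR : 0 < R)
    (hA : ∀ r ≥ R, ENNReal.ofReal r ^ a ≤ C * ENNReal.ofReal (A r)) {φ : E N → ℝ}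
    (hφ : MemSA p A φ) {x₀ : E N} (hx₀ : R ≤ ‖x₀‖) :
    ‖φ x₀‖ₑ ≤ decayFactor N p a C ‖x₀‖ * normA p A φ := by
  have h0 : 0 < ‖x₀‖ := hR.trans_le hx₀
  have hφ1 : ContDiff ℝ 1 φ := hφ.contDiff.of_le (by simp)
  -- A point on the ray through `x₀` and beyond the compact support.
  obtain ⟨x₁, hx₁, hφx₁⟩ : ∃ x₁ : E N, ‖x₀‖ ≤ ‖x₁‖ ∧ φ x₁ = 0 := by
    obtain ⟨ρ, hρ⟩ := hφ.hasCompactSupport.isCompact.isBounded.subset_ball 0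
    have hm : 1 ≤ max 1 (ρ / ‖x₀‖) := le_max_left _ _
    have hn : ‖(max 1 (ρ / ‖x₀‖)) • x₀‖ = max 1 (ρ / ‖x₀‖) * ‖x₀‖ := by
      rw [norm_smul, Real.norm_of_nonneg (by linarith)]
    refine ⟨(max 1 (ρ / ‖x₀‖)) • x₀, ?_, ?_⟩
    · rw [hn]; nlinarith
    · refine image_eq_zero_of_notMem_tsupport fun hmem => ?_
      have := hρ hmem
      rw [mem_ball_zero_iff, hn] at this
      have h3 : ρ / ‖x₀‖ * ‖x₀‖ ≤ max 1 (ρ / ‖x₀‖) * ‖x₀‖ := by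
        gcongr; exact le_max_right _ _
      rw [div_mul_cancel₀ _ h0.ne'] at h3
      linarith
  have hftc := radial_ftc hN hφ1 hφ.radial h0 hx₁
  rw [hφx₁, enorm_zero, zero_add] at hftc
  refine hftc.trans ?_
  rw [decayFactor, mul_assoc]
  gcongr _ * ?_
  set b := -(((N : ℝ) - 1) * p + a) / (p - 1) with hb
  have hp0 : 0 < p := by linarith
  have hp1 : p - 1 ≠ 0 := by linarith
  have hq : 0 ≤ 1 - 1 / p := by
    rw [sub_nonneg, div_le_one hp0]; exact hp.le
  have hfd : Measurable fun x => ‖fderiv ℝ φ x‖ₑ :=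
    (hφ1.continuous_fderiv one_ne_zero).enorm.measurable
  calc _ ≤ ∫⁻ x in (Metric.ball (0 : E N) ‖x₀‖)ᶜ,
            ‖fderiv ℝ φ x‖ₑ * ‖x‖ₑ ^ (-((N : ℝ) - 1)) := by
        refine lintegral_mono_set fun x hx => ?_
        have : ‖x₀‖ < ‖x‖ := hx.1
        simpa using this.le
    _ = ∫⁻ x in (Metric.ball (0 : E N) ‖x₀‖)ᶜ,
            (‖fderiv ℝ φ x‖ₑ ^ p * ‖x‖ₑ ^ a) ^ (1 / p) * (‖x‖ₑ ^ b) ^ (1 - 1 / p) := by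
        refine setLIntegral_congr_fun (measurableSet_compl_ball _) fun x hx => ?_
        have hx0 : 0 < ‖x‖ := h0.trans_le (norm_le_of_mem_compl_ball hx)
        rw [ENNReal.mul_rpow_of_nonneg _ _ (by positivity), ← ENNReal.rpow_mul,
          ← ENNReal.rpow_mul, ← ENNReal.rpow_mul, mul_one_div_cancel hp0.ne', ENNReal.rpow_one,
          mul_assoc, ← ENNReal.rpow_add _ _ (enorm_ne_zero_of_norm_pos hx0) enorm_ne_top]
        congr 2
        rw [hb]; field_simp; ring
    _ ≤ (∫⁻ x in (Metric.ball (0 : E N) ‖x₀‖)ᶜ, ‖fderiv ℝ φ x‖ₑ ^ p * ‖x‖ₑ ^ a) ^ (1 / p) *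
          (∫⁻ x in (Metric.ball (0 : E N) ‖x₀‖)ᶜ, ‖x‖ₑ ^ b) ^ (1 - 1 / p) :=
        ENNReal.lintegral_mul_norm_pow_le (by fun_prop) (by fun_prop) (by positivity) hq (by ring)
    _ ≤ (C ^ (1 / p) * normA p A φ) *
          (∫⁻ x in (Metric.ball (0 : E N) ‖x₀‖)ᶜ, ‖x‖ₑ ^ b) ^ (1 - 1 / p) := by
        gcongr
        exact lintegral_fderiv_le hp0 hC (fun r hr => hA r (hx₀.trans hr)) φ
    _ = _ := by ring

/-- The exponent `κ` is what remains of `|x|^(-(N-1))` once `|x|^(a/p)` is given to the gradient and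
`|x|^(-γ(1-1/p))` to `|φ|^(p-1)`. As `κ ≥ 0`, this remainder is largest at the inner radius and
leaves the integral. The outer point `x₁` is kept because `∫ |φ|^p |x|^(-γ)` will be controlled only
on bounded shells. -/
lemma enorm_rpow_le_add {N : ℕ} (hN : 0 < N) {p a γ κ : ℝ} (hp : 1 < p)
    (hκ : κ = (N : ℝ) - 1 + a / p - γ * (1 - 1 / p)) (hκ0 : 0 ≤ κ) {A : ℝ → ℝ}
    {C : ℝ≥0∞} (hC : C ≠ ⊤) {R : ℝ} (hR : 0 < R)
    (hA : ∀ r ≥ R, ENNReal.ofReal r ^ a ≤ C * ENNReal.ofReal (A r)) {φ : E N → ℝ}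
    (hφ : MemSA p A φ) {x₀ x₁ : E N} (hx₀ : R ≤ ‖x₀‖) (h01 : ‖x₀‖ ≤ ‖x₁‖) :
    ‖φ x₀‖ₑ ^ p ≤ ‖φ x₁‖ₑ ^ p + (sphereMass N)⁻¹ * (ENNReal.ofReal p * ‖x₀‖ₑ ^ (-κ) *
      (C ^ (1 / p) * normA p A φ *
      (∫⁻ x in {x : E N | ‖x‖ ∈ Ioc ‖x₀‖ ‖x₁‖}, ‖φ x‖ₑ ^ p * ‖x‖ₑ ^ (-γ)) ^ (1 - 1 / p))) := by
  have h0 : 0 < ‖x₀‖ := hR.trans_le hx₀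
  have hφ1 : ContDiff ℝ 1 φ := hφ.contDiff.of_le (by simp)
  have hp0 : 0 < p := by linarith
  have hq : 0 ≤ 1 - 1 / p := by
    rw [sub_nonneg, div_le_one hp0]; exact hp.le
  have hpow : ∀ x, ‖‖φ x‖ ^ p‖ₑ = ‖φ x‖ₑ ^ p := fun x => by
    rw [← ofReal_norm (φ x), ENNReal.ofReal_rpow_of_nonneg (norm_nonneg _) hp0.le,
      Real.enorm_of_nonneg (by positivity)]
  -- `|φ|^p` is of class `C^1`, even at zeros of `φ`, because `p > 1`.
  have hftc := radial_ftc hN (hφ1.norm_rpow hp)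
    (fun x y hxy => by rw [hφ.radial x y hxy]) h0 h01
  rw [hpow, hpow] at hftc
  refine hftc.trans ?_
  gcongr _ + _ * ?_
  have hfd : Measurable fun x => ‖fderiv ℝ φ x‖ₑ :=
    (hφ1.continuous_fderiv one_ne_zero).enorm.measurable
  have hφm : Measurable fun x => ‖φ x‖ₑ := hφ1.continuous.enorm.measurable
  have hS : MeasurableSet {x : E N | ‖x‖ ∈ Ioc ‖x₀‖ ‖x₁‖} := measurable_norm measurableSet_Ioc
  calc _ ≤ ∫⁻ x in {x : E N | ‖x‖ ∈ Ioc ‖x₀‖ ‖x₁‖}, ENNReal.ofReal p * ‖x₀‖ₑ ^ (-κ) *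
          ((‖fderiv ℝ φ x‖ₑ ^ p * ‖x‖ₑ ^ a) ^ (1 / p) *
            (‖φ x‖ₑ ^ p * ‖x‖ₑ ^ (-γ)) ^ (1 - 1 / p)) := by
        refine setLIntegral_mono' hS fun x hx => ?_
        have hx0 : 0 < ‖x‖ := h0.trans hx.1
        have hd : ‖fderiv ℝ (fun x => ‖φ x‖ ^ p) x‖ₑ ≤
            ENNReal.ofReal p * ‖φ x‖ₑ ^ (p - 1) * ‖fderiv ℝ φ x‖ₑ := by
          have := norm_fderiv_norm_rpow_le (hφ1.differentiable one_ne_zero) (x := x) hp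
          rw [← ofReal_norm, ← ofReal_norm (φ x), ← ofReal_norm (fderiv ℝ φ x),
            ENNReal.ofReal_rpow_of_nonneg (norm_nonneg _) (by linarith),
            ← ENNReal.ofReal_mul hp0.le, ← ENNReal.ofReal_mul (by positivity)]
          exact ENNReal.ofReal_le_ofReal this
        have hw : ‖x‖ₑ ^ (-((N : ℝ) - 1)) ≤
            ‖x₀‖ₑ ^ (-κ) * (‖x‖ₑ ^ (a * (1 / p)) * ‖x‖ₑ ^ (-γ * (1 - 1 / p))) := by
          have e : ‖x‖ₑ ^ (-((N : ℝ) - 1)) =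
              ‖x‖ₑ ^ (-κ) * (‖x‖ₑ ^ (a * (1 / p)) * ‖x‖ₑ ^ (-γ * (1 - 1 / p))) := by
            rw [← ENNReal.rpow_add _ _ (enorm_ne_zero_of_norm_pos hx0) enorm_ne_top,
              ← ENNReal.rpow_add _ _ (enorm_ne_zero_of_norm_pos hx0) enorm_ne_top]
            congr 1
            rw [hκ]; ring
          rw [e]
          gcongr ?_ * _
          rw [ENNReal.rpow_neg, ENNReal.rpow_neg, ENNReal.inv_le_inv]
          gcongr
          rw [← ofReal_norm, ← ofReal_norm]
          exact ENNReal.ofReal_le_ofReal hx.1.le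
        rw [ENNReal.mul_rpow_of_nonneg _ _ (by positivity), ENNReal.mul_rpow_of_nonneg _ _ hq,
          ← ENNReal.rpow_mul, ← ENNReal.rpow_mul, ← ENNReal.rpow_mul, ← ENNReal.rpow_mul,
          mul_one_div_cancel hp0.ne', ENNReal.rpow_one, mul_sub, mul_one_div_cancel hp0.ne',
          mul_one]
        refine (mul_le_mul' hd hw).trans_eq ?_
        ring
    _ = ENNReal.ofReal p * ‖x₀‖ₑ ^ (-κ) * ∫⁻ x in {x : E N | ‖x‖ ∈ Ioc ‖x₀‖ ‖x₁‖},
          ((‖fderiv ℝ φ x‖ₑ ^ p * ‖x‖ₑ ^ a) ^ (1 / p) *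
            (‖φ x‖ₑ ^ p * ‖x‖ₑ ^ (-γ)) ^ (1 - 1 / p)) :=
        lintegral_const_mul _ (by fun_prop)
    _ ≤ ENNReal.ofReal p * ‖x₀‖ₑ ^ (-κ) *
          ((∫⁻ x in {x : E N | ‖x‖ ∈ Ioc ‖x₀‖ ‖x₁‖},
            ‖fderiv ℝ φ x‖ₑ ^ p * ‖x‖ₑ ^ a) ^ (1 / p) *
          (∫⁻ x in {x : E N | ‖x‖ ∈ Ioc ‖x₀‖ ‖x₁‖},
            ‖φ x‖ₑ ^ p * ‖x‖ₑ ^ (-γ)) ^ (1 - 1 / p)) := by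
        gcongr
        exact ENNReal.lintegral_mul_norm_pow_le (by fun_prop) (by fun_prop) (by positivity) hq
          (by ring)
    _ ≤ _ := by
        gcongr
        refine le_trans ?_ (lintegral_fderiv_le hp0 hC hA φ)
        gcongr
        intro x hx
        have : ‖x₀‖ < ‖x‖ := hx.1
        simpa using (hx₀.trans this.le)

/-! ### From Cauchy sequences to elements of `X`. -/

lemma Represents.aemeasurable {N : ℕ} {p : ℝ} {A : ℝ → ℝ} {φ : ℕ → E N → ℝ} {u : E N → ℝ}
    (h : Represents p A φ u) : AEMeasurable u :=
  aemeasurable_of_tendsto_metrizable_ae atTop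
    (fun n => (h.mem n).contDiff.continuous.aemeasurable) h.tendsto

lemma exists_represents_of_normDA_lt {N : ℕ} {p : ℝ} {A : ℝ → ℝ} {u : E N → ℝ} {c : ℝ≥0∞}
    (h : normDA p A u < c) :
    ∃ φ, Represents p A φ u ∧ ∀ᶠ n in atTop, normA p A (φ n) ≤ c := by
  obtain ⟨l, ⟨φ, hφ, hl⟩, hlc⟩ := sInf_lt_iff.1 h
  exact ⟨φ, hφ, (hl.eventually_lt_const hlc).mono fun _ h => h.le⟩

lemma normX_eq_one {N : ℕ} {p : ℝ} (hp : 0 < p) {A V : ℝ → ℝ} {u : E N → ℝ}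
    (h : normX p A V u = 1) : normDA p A u ≤ 1 ∧ normLVPow p V u ≤ 1 := by
  have h1 : normDA p A u ^ p + normLVPow p V u = 1 := by
    have := congrArg (· ^ p) h
    simpa [normX, ← ENNReal.rpow_mul, hp.ne'] using this
  refine ⟨?_, h1 ▸ le_add_self⟩
  have h2 : normDA p A u ^ p ≤ 1 := h1 ▸ le_self_add
  exact le_of_not_gt fun h3 => (ENNReal.one_lt_rpow h3 hp).not_ge h2

/-- Pointwise decay of the elements of the unit sphere of `X`. -/
lemma exists_ae_rpow_le {N : ℕ} (hN : 0 < N) {p a γ κ : ℝ} (hp : 1 < p) (ha : p - N < a)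
    (hκ : κ = (N : ℝ) - 1 + a / p - γ * (1 - 1 / p)) (hκ0 : 0 ≤ κ) {A V : ℝ → ℝ}
    {C : ℝ≥0∞} (hC : C ≠ ⊤) {R₁ : ℝ}
    (hA : ∀ r ≥ R₁, ENNReal.ofReal r ^ a ≤ C * ENNReal.ofReal (A r))
    {M : ℝ≥0∞} (hM : M ≠ ⊤) {R₂ : ℝ}
    (hV : ∀ᵐ x : E N, R₂ < ‖x‖ → ‖x‖ₑ ^ (-γ) ≤ M * ENNReal.ofReal (V ‖x‖)) :
    ∃ R₀ : ℝ, 0 < R₀ ∧ ∃ D : ℝ≥0∞, D ≠ ⊤ ∧ ∀ u : E N → ℝ, normX p A V u = 1 →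
      ∀ᵐ x, R₀ ≤ ‖x‖ → ‖u x‖ₑ ^ p ≤ D * ‖x‖ₑ ^ (-κ) := by
  have hp0 : 0 < p := by linarith
  have hq0 : 0 < 1 - 1 / p := by
    rw [sub_pos, div_lt_one hp0]; exact hp
  have hG := tendsto_decayFactor hN hp ha hC
  -- Beyond `R₀` the decay factor is below `1`, which will give a constant bound for the
  -- approximating functions.
  obtain ⟨R₀, hR₀G, hR₀⟩ := ((hG.eventually_lt_const one_pos).and
    (eventually_ge_atTop (max 1 (max R₁ R₂)))).exists
  have hR₀0 : 0 < R₀ := lt_of_lt_of_le one_pos ((le_max_left _ _).trans hR₀)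
  have hR₀1 : R₁ ≤ R₀ := ((le_max_left _ _).trans (le_max_right _ _)).trans hR₀
  have hR₀2 : R₂ ≤ R₀ := ((le_max_right _ _).trans (le_max_right _ _)).trans hR₀
  have hA' : ∀ r ≥ R₀, ENNReal.ofReal r ^ a ≤ C * ENNReal.ofReal (A r) :=
    fun r hr => hA r (hR₀1.trans hr)
  set D : ℝ≥0∞ := (sphereMass N)⁻¹ * (ENNReal.ofReal p * (C ^ (1 / p) * 2 * M ^ (1 - 1 / p)))
    with hD
  refine ⟨R₀, hR₀0, D, ?_, fun u hu => ?_⟩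
  · refine ENNReal.mul_ne_top (ENNReal.inv_ne_top.2 (sphereMass_ne_zero hN))
      (ENNReal.mul_ne_top ENNReal.ofReal_ne_top (ENNReal.mul_ne_top (ENNReal.mul_ne_top
        (ENNReal.rpow_ne_top_of_nonneg (by positivity) hC) ENNReal.ofNat_ne_top)
        (ENNReal.rpow_ne_top_of_nonneg hq0.le hM)))
  obtain ⟨hu1, hu2⟩ := normX_eq_one hp0 hu
  -- The infimum defining `normDA` need not be known to be attained; any bound above `1`, here `2`,
  -- is enough and enters `D`.
  obtain ⟨φ, hφ, hφ2⟩ := exists_represents_of_normDA_lt (hu1.trans_lt (by norm_num : (1 : ℝ≥0∞) < 2))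
  filter_upwards [hφ.tendsto] with x₀ hx₀ hx₀R
  have h0 : 0 < ‖x₀‖ := hR₀0.trans_le hx₀R
  have hVint : ∀ R, ∫⁻ x in {x : E N | ‖x‖ ∈ Ioc ‖x₀‖ R}, ‖u x‖ₑ ^ p * ‖x‖ₑ ^ (-γ) ≤ M := by
    intro R
    have hS : MeasurableSet {x : E N | ‖x‖ ∈ Ioc ‖x₀‖ R} := measurable_norm measurableSet_Ioc
    calc _ ≤ ∫⁻ x in {x : E N | ‖x‖ ∈ Ioc ‖x₀‖ R}, M * (ENNReal.ofReal (V ‖x‖) * ‖u x‖ₑ ^ p) := by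
          refine lintegral_mono_ae ((ae_restrict_iff' hS).2 ?_)
          filter_upwards [hV] with x hx hxS
          have h1 : ‖x₀‖ < ‖x‖ := hxS.1
          rw [mul_comm, ← mul_assoc]
          gcongr
          exact hx (hR₀2.trans_lt (hx₀R.trans_lt h1))
      _ = M * ∫⁻ x in {x : E N | ‖x‖ ∈ Ioc ‖x₀‖ R}, (ENNReal.ofReal (V ‖x‖) * ‖u x‖ₑ ^ p) :=
          lintegral_const_mul' _ _ hM
      _ ≤ M * 1 := by
          gcongr
          exact (setLIntegral_le_lintegral _ _).trans hu2
      _ = M := mul_one M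
  have hshell : ∀ R, ‖x₀‖ ≤ R → ‖u x₀‖ₑ ^ p ≤ (decayFactor N p a C R * 2) ^ p +
      D * ‖x₀‖ₑ ^ (-κ) := by
    intro R hR
    have hS : MeasurableSet {x : E N | ‖x‖ ∈ Ioc ‖x₀‖ R} := measurable_norm measurableSet_Ioc
    -- Pointwise convergence may fail at `x₁`. Only the values `φ n x₁` are used, and they are
    -- bounded by the decay factor at every point.
    set x₁ : E N := (R / ‖x₀‖) • x₀ with hx₁
    have hx₁n : ‖x₁‖ = R := by
      rw [hx₁, norm_smul, Real.norm_of_nonneg (by have := h0.le.trans hR; positivity),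
        div_mul_cancel₀ _ h0.ne']
    have hdec : ∀ᶠ n in atTop, ∀ x, R₀ ≤ ‖x‖ → ‖φ n x‖ₑ ≤ decayFactor N p a C ‖x‖ * 2 := by
      filter_upwards [hφ2] with n hn x hx
      refine (enorm_le_decayFactor_mul hN hp hC hR₀0 hA' (hφ.mem n) hx).trans ?_
      gcongr
    have hlim : Tendsto (fun n => ∫⁻ x in {x : E N | ‖x‖ ∈ Ioc ‖x₀‖ R},
        ‖φ n x‖ₑ ^ p * ‖x‖ₑ ^ (-γ)) atTop
        (𝓝 (∫⁻ x in {x : E N | ‖x‖ ∈ Ioc ‖x₀‖ R}, ‖u x‖ₑ ^ p * ‖x‖ₑ ^ (-γ))) := by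
      -- On the shell `|φ n| ≤ 2`, and `|x|^(-γ)` is at most the sum of its values at the two radii,
      -- whatever the sign of `γ`.
      refine tendsto_lintegral_filter_of_dominated_convergence
        (fun _ => 2 ^ p * (ENNReal.ofReal ‖x₀‖ ^ (-γ) + ENNReal.ofReal R ^ (-γ))) ?_ ?_ ?_ ?_
      · refine Eventually.of_forall fun n => ?_
        have := (hφ.mem n).contDiff.continuous.enorm.measurable
        fun_prop
      · filter_upwards [hdec] with n hn
        refine (ae_restrict_iff' hS).2 (ae_of_all _ fun x hx => ?_)
        have h1 : ‖x₀‖ < ‖x‖ := hx.1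
        have h2 : ‖x‖ ≤ R := hx.2
        gcongr ?_ ^ p * ?_
        · refine (hn x (hx₀R.trans h1.le)).trans ?_
          calc decayFactor N p a C ‖x‖ * 2 ≤ 1 * 2 := by
                gcongr
                exact (decayFactor_anti hp C (hx₀R.trans h1.le)).trans hR₀G.le
            _ = 2 := one_mul _
        · rw [← ofReal_norm]
          rcases le_total 0 γ with hγ | hγ
          · refine le_trans ?_ le_self_add
            rw [ENNReal.rpow_neg, ENNReal.rpow_neg, ENNReal.inv_le_inv]
            gcongr
          · refine le_trans ?_ le_add_self
            have : 0 ≤ -γ := by linarith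
            gcongr
      · rw [lintegral_const]
        refine ENNReal.mul_ne_top (ENNReal.mul_ne_top
          (ENNReal.rpow_ne_top_of_nonneg hp0.le ENNReal.ofNat_ne_top)
          (ENNReal.add_ne_top.2 ⟨?_, ?_⟩)) ?_
        · exact ENNReal.rpow_ne_top_of_ne_zero (by simpa using h0.ne') ENNReal.ofReal_ne_top
        · exact ENNReal.rpow_ne_top_of_ne_zero (by simpa using h0.trans_le hR)
            ENNReal.ofReal_ne_top
        · rw [Measure.restrict_apply_univ]
          refine ne_top_of_le_ne_top (measure_closedBall_lt_top (x := (0 : E N)) (r := R)).ne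
            (measure_mono fun x hx => ?_)
          simpa using hx.2
      · refine (ae_restrict_iff' hS).2 ?_
        filter_upwards [hφ.tendsto] with x hx hxS
        have h1 := (hx.enorm).ennrpow_const p
        exact ENNReal.Tendsto.mul_const h1 (Or.inr (ENNReal.rpow_ne_top_of_ne_zero
          (enorm_ne_zero_of_norm_pos (h0.trans hxS.1)) enorm_ne_top))
    have h1 : Tendsto (fun n => ‖φ n x₀‖ₑ ^ p) atTop (𝓝 (‖u x₀‖ₑ ^ p)) :=
      (hx₀.enorm).ennrpow_const p
    have hbd : ∀ᶠ n in atTop, ‖φ n x₀‖ₑ ^ p ≤ (decayFactor N p a C R * 2) ^ p +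
        (sphereMass N)⁻¹ * (ENNReal.ofReal p * ‖x₀‖ₑ ^ (-κ) * (C ^ (1 / p) * 2 *
      (∫⁻ x in {x : E N | ‖x‖ ∈ Ioc ‖x₀‖ R}, ‖φ n x‖ₑ ^ p * ‖x‖ₑ ^ (-γ)) ^ (1 - 1 / p))) := by
      filter_upwards [hφ2, hdec] with n hn hnd
      have h3 := enorm_rpow_le_add hN hp hκ hκ0 hC hR₀0 hA' (hφ.mem n) hx₀R
        (hR.trans_eq hx₁n.symm)
      have h4 := hnd x₁ (hx₁n ▸ hx₀R.trans hR)
      rw [hx₁n] at h3 h4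
      refine h3.trans ?_
      gcongr
    have hx₀w : ‖x₀‖ₑ ^ (-κ) ≠ ⊤ :=
      ENNReal.rpow_ne_top_of_ne_zero (enorm_ne_zero_of_norm_pos h0) enorm_ne_top
    have h5 := (hlim.ennrpow_const (1 - 1 / p))
    have h6 := ENNReal.Tendsto.const_mul h5 (a := C ^ (1 / p) * 2)
      (Or.inr (ENNReal.mul_ne_top (ENNReal.rpow_ne_top_of_nonneg (by positivity) hC)
        ENNReal.ofNat_ne_top))
    have h7 := ENNReal.Tendsto.const_mul h6 (a := ENNReal.ofReal p * ‖x₀‖ₑ ^ (-κ))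
      (Or.inr (ENNReal.mul_ne_top ENNReal.ofReal_ne_top hx₀w))
    have h8 := ENNReal.Tendsto.const_mul h7 (a := (sphereMass N)⁻¹)
      (Or.inr (ENNReal.inv_ne_top.2 (sphereMass_ne_zero hN)))
    have h9 := h8.const_add ((decayFactor N p a C R * 2) ^ p)
    refine (le_of_tendsto_of_tendsto h1 h9 hbd).trans ?_
    gcongr _ + ?_
    calc _ ≤ (sphereMass N)⁻¹ * (ENNReal.ofReal p * ‖x₀‖ₑ ^ (-κ) *
            (C ^ (1 / p) * 2 * M ^ (1 - 1 / p))) := by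
          gcongr
          exact hVint R
      _ = D * ‖x₀‖ₑ ^ (-κ) := by rw [hD]; ring
  -- Sending the outer radius to infinity removes the boundary term at `x₁`.
  have hGlim : Tendsto (fun R => (decayFactor N p a C R * 2) ^ p + D * ‖x₀‖ₑ ^ (-κ)) atTop
      (𝓝 (D * ‖x₀‖ₑ ^ (-κ))) := by
    have h1 := (ENNReal.Tendsto.mul_const (b := 2) hG (Or.inr ENNReal.ofNat_ne_top)).ennrpow_const p
    rw [zero_mul, ENNReal.zero_rpow_of_pos hp0] at h1
    simpa using h1.add_const (D * ‖x₀‖ₑ ^ (-κ))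
  exact ge_of_tendsto hGlim ((eventually_ge_atTop ‖x₀‖).mono hshell)

/-! ### Integral estimates outside large balls. -/

/-- A lower bound on `v` allows its exponent to be raised at the price of a power of `w`. With `v =
V(|x|)`, `w = |x|` and `s = β`, it serves with `t = 1` when `q ≥ p` and with `t = q/p` when `q < p`.
-/
lemma rpow_le_rpow_mul_of_rpow_neg_le {v w M : ℝ≥0∞} {γ s t : ℝ} (hv : v ≠ ⊤) (hw0 : w ≠ 0)
    (hw : w ≠ ⊤) (h : w ^ (-γ) ≤ M * v) (hst : s ≤ t) :
    v ^ s ≤ M ^ (t - s) * w ^ (γ * (t - s)) * v ^ t := by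
  have hv0 : v ≠ 0 := by
    rintro rfl
    rw [mul_zero, nonpos_iff_eq_zero] at h
    exact (ENNReal.rpow_pos hw0.bot_lt hw).ne' h
  have hts : 0 ≤ t - s := sub_nonneg.2 hst
  have h1 : v⁻¹ ≤ M * w ^ γ := by
    rw [ENNReal.rpow_neg] at h
    calc v⁻¹ = v⁻¹ * (w ^ γ)⁻¹ * w ^ γ := by
          rw [mul_assoc, ENNReal.inv_mul_cancel (ENNReal.rpow_pos hw0.bot_lt hw).ne'
            (ENNReal.rpow_ne_top_of_ne_zero hw0 hw), mul_one]
      _ ≤ v⁻¹ * (M * v) * w ^ γ := by gcongr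
      _ = M * w ^ γ := by
          rw [mul_left_comm, ENNReal.inv_mul_cancel hv0 hv, mul_one]
  calc v ^ s = v⁻¹ ^ (t - s) * v ^ t := by
        rw [ENNReal.inv_rpow, ← ENNReal.rpow_neg, ← ENNReal.rpow_add _ _ hv0 hv]
        congr 1; ring
    _ ≤ (M * w ^ γ) ^ (t - s) * v ^ t := by gcongr
    _ = _ := by rw [ENNReal.mul_rpow_of_nonneg _ _ hts, ENNReal.rpow_mul]

/-- A bound on the integrals over complements of balls that is uniform on the unit sphere
of `X` bounds `supInfty`. -/
lemma tendsto_supInfty {N : ℕ} {p q : ℝ} {A V K : ℝ → ℝ} {B : ℝ → ℝ≥0∞}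
    (hB : Tendsto B atTop (𝓝 0))
    (h : ∀ᶠ R in atTop, ∀ u : E N → ℝ, MemX p A V u → normX p A V u = 1 →
      ∫⁻ x in (Metric.ball (0 : E N) R)ᶜ, ENNReal.ofReal (K ‖x‖) * ‖u x‖ₑ ^ q ≤ B R) :
    Tendsto (fun R : ℝ => supInfty N p A V K q R) atTop (𝓝 0) :=
  tendsto_of_tendsto_of_tendsto_of_le_of_le' tendsto_const_nhds hB
    (Eventually.of_forall fun _ => zero_le)
    (h.mono fun _ hR => iSup_le fun u => iSup_le fun hu => iSup_le fun hu1 => hR u hu hu1)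

/-- Write `|u|^q = (|u|^p)^((q-p)/p) |u|^p`, bound the first factor by the pointwise decay, and
replace `V^β` by `M^(1-β) |x|^(γ(1-β)) V`. The total power `|x|^θ` is at most `R^θ`, and `∫ V|u|^p ≤
1` remains. -/
lemma tendsto_supInfty_of_le {N : ℕ} (hN : 0 < N) {p a γ κ α β q : ℝ} (hp : 1 < p)
    (ha : p - N < a) (hκ : κ = (N : ℝ) - 1 + a / p - γ * (1 - 1 / p)) (hκ0 : 0 ≤ κ)
    (hβ : β ≤ 1) (hpq : p ≤ q) (hθ : α + γ * (1 - β) - κ * ((q - p) / p) < 0)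
    {A V K : ℝ → ℝ} {C : ℝ≥0∞} (hC : C ≠ ⊤) {R₁ : ℝ}
    (hA : ∀ r ≥ R₁, ENNReal.ofReal r ^ a ≤ C * ENNReal.ofReal (A r))
    {L M : ℝ≥0∞} (hL : L ≠ ⊤) (hM : M ≠ ⊤) {R₂ : ℝ}
    (hK : ∀ᵐ x : E N, R₂ < ‖x‖ →
      ENNReal.ofReal (K ‖x‖) ≤ L * (‖x‖ₑ ^ α * ENNReal.ofReal (V ‖x‖) ^ β))
    (hV : ∀ᵐ x : E N, R₂ < ‖x‖ → ‖x‖ₑ ^ (-γ) ≤ M * ENNReal.ofReal (V ‖x‖)) :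
    Tendsto (fun R : ℝ => supInfty N p A V K q R) atTop (𝓝 0) := by
  have hp0 : 0 < p := by linarith
  obtain ⟨R₀, hR₀, D, hD, hu⟩ := exists_ae_rpow_le hN hp ha hκ hκ0 hC hA hM hV
  set θ := α + γ * (1 - β) - κ * ((q - p) / p) with hθd
  have hqp : 0 ≤ (q - p) / p := div_nonneg (by linarith) hp0.le
  set B : ℝ≥0∞ := L * M ^ (1 - β) * D ^ ((q - p) / p) with hBd
  have hB : B ≠ ⊤ := ENNReal.mul_ne_top (ENNReal.mul_ne_top hL
    (ENNReal.rpow_ne_top_of_nonneg (by linarith) hM)) (ENNReal.rpow_ne_top_of_nonneg hqp hD)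
  have hlim := ENNReal.Tendsto.const_mul (tendsto_ofReal_rpow_nhds_zero hθ) (a := B) (Or.inr hB)
  rw [mul_zero] at hlim
  refine tendsto_supInfty hlim ?_
  filter_upwards [eventually_ge_atTop R₀, eventually_gt_atTop R₂] with R hR0 hR2 u _ hu1
  have hRt : ENNReal.ofReal R ^ θ ≠ ⊤ := ENNReal.rpow_ne_top_of_ne_zero
    (by simpa using hR₀.trans_le hR0) ENNReal.ofReal_ne_top
  calc ∫⁻ x in (Metric.ball (0 : E N) R)ᶜ, ENNReal.ofReal (K ‖x‖) * ‖u x‖ₑ ^ q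
      ≤ ∫⁻ x in (Metric.ball (0 : E N) R)ᶜ, B * ENNReal.ofReal R ^ θ *
          (ENNReal.ofReal (V ‖x‖) * ‖u x‖ₑ ^ p) := by
        refine lintegral_mono_ae ((ae_restrict_iff' (measurableSet_compl_ball R)).2 ?_)
        filter_upwards [hK, hV, hu u hu1] with x hxK hxV hxu hxR
        have hRx : R ≤ ‖x‖ := norm_le_of_mem_compl_ball hxR
        have hx0 : ‖x‖ₑ ≠ 0 :=
          enorm_ne_zero_of_norm_pos ((hR₀.trans_le hR0).trans_le hRx)
        have e1 : ‖u x‖ₑ ^ q = (‖u x‖ₑ ^ p) ^ ((q - p) / p) * ‖u x‖ₑ ^ p := by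
          rw [← ENNReal.rpow_mul, mul_div_cancel₀ _ hp0.ne',
            ← ENNReal.rpow_add_of_nonneg _ _ (by linarith) hp0.le, sub_add_cancel]
        have h1 := rpow_le_rpow_mul_of_rpow_neg_le ENNReal.ofReal_ne_top hx0 enorm_ne_top
          (hxV (hR2.trans_le hRx)) hβ
        rw [ENNReal.rpow_one] at h1
        have h2 : ‖x‖ₑ ^ θ ≤ ENNReal.ofReal R ^ θ := by
          have h3 : ∀ τ : ℝ, 0 ≤ τ → ‖x‖ₑ ^ (-τ) ≤ ENNReal.ofReal R ^ (-τ) := fun τ hτ => by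
            rw [ENNReal.rpow_neg, ENNReal.rpow_neg, ENNReal.inv_le_inv, ← ofReal_norm]
            gcongr
          simpa using h3 (-θ) (by linarith)
        have e2 : ‖x‖ₑ ^ θ =
            ‖x‖ₑ ^ α * ‖x‖ₑ ^ (γ * (1 - β)) * ‖x‖ₑ ^ (-κ * ((q - p) / p)) := by
          rw [← ENNReal.rpow_add _ _ hx0 enorm_ne_top, ← ENNReal.rpow_add _ _ hx0 enorm_ne_top]
          congr 1; rw [hθd]; ring
        calc ENNReal.ofReal (K ‖x‖) * ‖u x‖ₑ ^ q
            ≤ (L * (‖x‖ₑ ^ α * (M ^ (1 - β) * ‖x‖ₑ ^ (γ * (1 - β)) * ENNReal.ofReal (V ‖x‖)))) *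
              ((D * ‖x‖ₑ ^ (-κ)) ^ ((q - p) / p) * ‖u x‖ₑ ^ p) := by
              rw [e1]
              gcongr
              · refine (hxK (hR2.trans_le hRx)).trans ?_
                gcongr
              · exact hxu (hR0.trans hRx)
          _ = B * ‖x‖ₑ ^ θ * (ENNReal.ofReal (V ‖x‖) * ‖u x‖ₑ ^ p) := by
              rw [ENNReal.mul_rpow_of_nonneg _ _ hqp, ← ENNReal.rpow_mul, e2, hBd]
              ring
          _ ≤ _ := by gcongr
    _ = B * ENNReal.ofReal R ^ θ * ∫⁻ x in (Metric.ball (0 : E N) R)ᶜ,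
          (ENNReal.ofReal (V ‖x‖) * ‖u x‖ₑ ^ p) :=
        lintegral_const_mul' _ _ (ENNReal.mul_ne_top hB hRt)
    _ ≤ B * ENNReal.ofReal R ^ θ * 1 := by
        gcongr
        exact (setLIntegral_le_lintegral _ _).trans (normX_eq_one hp0 hu1).2
    _ = B * ENNReal.ofReal R ^ θ := mul_one _

/-- After `V^β` is raised to `V^(q/p)`, the integrand contains `(V|u|^p)^(q/p)`. Hölder with the
weights `q/p` and `1 - q/p` separates it from `|x|^b`, whose tail tends to `0`. -/
lemma tendsto_supInfty_of_lt {N : ℕ} {p γ α β q : ℝ} (hp : 0 < p) (hq : 0 < q)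
    (hβq : β ≤ q / p) (hqp : q < p)
    (hθ : (α + γ * (q / p - β)) / (1 - q / p) < -N)
    {A V K : ℝ → ℝ} (hVm : AEMeasurable (fun x : E N => V ‖x‖))
    {L M : ℝ≥0∞} (hL : L ≠ ⊤) (hM : M ≠ ⊤) {R₂ : ℝ}
    (hK : ∀ᵐ x : E N, R₂ < ‖x‖ →
      ENNReal.ofReal (K ‖x‖) ≤ L * (‖x‖ₑ ^ α * ENNReal.ofReal (V ‖x‖) ^ β))
    (hV : ∀ᵐ x : E N, R₂ < ‖x‖ → ‖x‖ₑ ^ (-γ) ≤ M * ENNReal.ofReal (V ‖x‖)) :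
    Tendsto (fun R : ℝ => supInfty N p A V K q R) atTop (𝓝 0) := by
  have hqp0 : 0 < q / p := div_pos hq hp
  have hqp1 : 0 < 1 - q / p := by rw [sub_pos, div_lt_one hp]; exact hqp
  set b := (α + γ * (q / p - β)) / (1 - q / p) with hbd
  set B : ℝ≥0∞ := L * M ^ (q / p - β) with hBd
  have hB : B ≠ ⊤ := ENNReal.mul_ne_top hL (ENNReal.rpow_ne_top_of_nonneg (by linarith) hM)
  have hlim := (tendsto_tail (N := N) hθ).ennrpow_const (1 - q / p)
  rw [ENNReal.zero_rpow_of_pos hqp1] at hlim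
  have hlim2 := ENNReal.Tendsto.const_mul hlim (a := B) (Or.inr hB)
  rw [mul_zero] at hlim2
  refine tendsto_supInfty hlim2 ?_
  filter_upwards [eventually_gt_atTop 0, eventually_gt_atTop R₂] with R hR0 hR2 u hu hu1
  have hum : AEMeasurable u := by
    obtain ⟨φ, hφ⟩ := hu.1
    exact hφ.aemeasurable
  have hfm : AEMeasurable (fun x : E N => ENNReal.ofReal (V ‖x‖) * ‖u x‖ₑ ^ p) :=
    hVm.ennreal_ofReal.mul (hum.enorm.pow_const p)
  calc ∫⁻ x in (Metric.ball (0 : E N) R)ᶜ, ENNReal.ofReal (K ‖x‖) * ‖u x‖ₑ ^ q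
      ≤ ∫⁻ x in (Metric.ball (0 : E N) R)ᶜ, B *
          ((ENNReal.ofReal (V ‖x‖) * ‖u x‖ₑ ^ p) ^ (q / p) * (‖x‖ₑ ^ b) ^ (1 - q / p)) := by
        refine lintegral_mono_ae ((ae_restrict_iff' (measurableSet_compl_ball R)).2 ?_)
        filter_upwards [hK, hV] with x hxK hxV hxR
        have hRx : R ≤ ‖x‖ := norm_le_of_mem_compl_ball hxR
        have hx0 : ‖x‖ₑ ≠ 0 := enorm_ne_zero_of_norm_pos (hR0.trans_le hRx)
        have h1 := rpow_le_rpow_mul_of_rpow_neg_le ENNReal.ofReal_ne_top hx0 enorm_ne_top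
          (hxV (hR2.trans_le hRx)) hβq
        have e2 : (‖x‖ₑ ^ b) ^ (1 - q / p) = ‖x‖ₑ ^ α * ‖x‖ₑ ^ (γ * (q / p - β)) := by
          rw [← ENNReal.rpow_mul, ← ENNReal.rpow_add _ _ hx0 enorm_ne_top, hbd,
            div_mul_cancel₀ _ hqp1.ne']
        calc ENNReal.ofReal (K ‖x‖) * ‖u x‖ₑ ^ q
            ≤ (L * (‖x‖ₑ ^ α * (M ^ (q / p - β) * ‖x‖ₑ ^ (γ * (q / p - β)) *
                ENNReal.ofReal (V ‖x‖) ^ (q / p)))) * ‖u x‖ₑ ^ q := by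
              gcongr
              refine (hxK (hR2.trans_le hRx)).trans ?_
              gcongr
          _ = _ := by
              rw [ENNReal.mul_rpow_of_nonneg _ _ hqp0.le, ← ENNReal.rpow_mul,
                mul_div_cancel₀ _ hp.ne', e2, hBd]
              ring
    _ = B * ∫⁻ x in (Metric.ball (0 : E N) R)ᶜ,
          ((ENNReal.ofReal (V ‖x‖) * ‖u x‖ₑ ^ p) ^ (q / p) * (‖x‖ₑ ^ b) ^ (1 - q / p)) :=
        lintegral_const_mul' _ _ hB
    _ ≤ B * ((∫⁻ x in (Metric.ball (0 : E N) R)ᶜ,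
          (ENNReal.ofReal (V ‖x‖) * ‖u x‖ₑ ^ p)) ^ (q / p) *
          (∫⁻ x in (Metric.ball (0 : E N) R)ᶜ, ‖x‖ₑ ^ b) ^ (1 - q / p)) := by
        gcongr
        exact ENNReal.lintegral_mul_norm_pow_le hfm.restrict (by fun_prop) hqp0.le hqp1.le
          (by ring)
    _ ≤ B * (1 ^ (q / p) *
          (∫⁻ x in (Metric.ball (0 : E N) R)ᶜ, ‖x‖ₑ ^ b) ^ (1 - q / p)) := by
        gcongr
        exact (setLIntegral_le_lintegral _ _).trans (normX_eq_one hp hu1).2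
    _ = _ := by rw [ENNReal.one_rpow, one_mul]

end RadialEmbedding

end

/-! ### The two ranges of the exponent. -/

theorem theorem3p2 (N : ℕ) (hN : 3 ≤ N) (p : ℝ) (hp : 1 < p) (hpN : p < N)
    (A V K : ℝ → ℝ) (a₀ aInf : ℝ)
    (hA : RadialEmbedding.HypA N p a₀ aInf A)
    (hV : RadialEmbedding.HypV V) (hK : RadialEmbedding.HypK K)
    (R₂ : ℝ) (hR₂ : 0 < R₂) (α β γ : ℝ) (hβ₀ : 0 ≤ β) (hβ₁ : β ≤ 1)
    (hKV : essSup (fun r : ℝ => ENNReal.ofReal (K r) / ENNReal.ofReal (r ^ α * V r ^ β))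
      (volume.restrict (Ioi R₂)) < ⊤)
    (hγ : γ ≤ p - aInf)
    (hVγ : 0 < essInf (fun r : ℝ => ENNReal.ofReal (r ^ γ * V r)) (volume.restrict (Ioi R₂)))
    (q₂ : ℝ)
    (hq₁ : 1 < q₂) (hqβ : p * β < q₂)
    (hqStar : RadialEmbedding.qStar N p α β γ < q₂)
    (hqStarStar : RadialEmbedding.qStarStar N p aInf α β γ < q₂) :
    Tendsto (fun R : ℝ => RadialEmbedding.supInfty N p A V K q₂ R) atTop (𝓝 0) := by
  have hp0 : 0 < p := by linarith
  have hN0 : 0 < N := by lia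
  have ha : p - N < aInf := hA.aInf_mem.1
  obtain ⟨C, hC, R₁, -, hA'⟩ := hA.exists_rpow_le
  obtain ⟨L, hL, hKL⟩ :=
    RadialEmbedding.exists_ae_le_of_essSup_lt_top hR₂ hβ₀ hV.nonneg hKV
  obtain ⟨M, hM, hVM⟩ := RadialEmbedding.exists_ae_rpow_le_of_essInf_pos hR₂ hVγ
  have hK' := RadialEmbedding.ae_norm_of_ae hN0 hKL
  have hV' := RadialEmbedding.ae_norm_of_ae hN0 hVM
  simp only [ofReal_norm] at hK' hV'
  rcases le_or_gt p q₂ with hpq | hqp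
  -- By `γ ≤ p - aInf` this denominator, which equals `p κ`, is at least `p (N - p + aInf) > 0`.
  · have hden : 0 < p * ((N : ℝ) - 1) - γ * (p - 1) + aInf := by
      nlinarith
    set κ : ℝ := (N : ℝ) - 1 + aInf / p - γ * (1 - 1 / p) with hκ
    have hκp : p * κ = p * ((N : ℝ) - 1) - γ * (p - 1) + aInf := by
      rw [hκ]; field_simp; ring
    have hκ0 : 0 < κ := pos_of_mul_pos_right (hκp ▸ hden) hp0.le
    refine RadialEmbedding.tendsto_supInfty_of_le hN0 hp ha hκ hκ0.le hβ₁ hpq ?_ hC hA' hL hM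
      hK' hV'
    rw [RadialEmbedding.qStarStar, ← mul_div_assoc, ← hκp, div_lt_iff₀ (by positivity)]
      at hqStarStar
    have h1 : p * α + (1 - p * β) * γ + p * ((N : ℝ) - 1) + aInf < q₂ * κ := by
      nlinarith
    -- After expanding `p κ`, this is `h1` rearranged: the decay exponent is negative exactly above
    -- `q_**`.
    have h2 : p * (α + γ * (1 - β) - κ * ((q₂ - p) / p)) < 0 := by
      have : p * (α + γ * (1 - β) - κ * ((q₂ - p) / p)) =
          p * α + p * γ * (1 - β) - κ * (q₂ - p) := by field_simp
      rw [this]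
      nlinarith
    exact (pos_iff_neg_of_mul_neg h2).1 hp0
  · have hden : 0 < (N : ℝ) - γ := by linarith
    have hqp1 : 0 < 1 - q₂ / p := by rw [sub_pos, div_lt_one hp0]; exact hqp
    refine RadialEmbedding.tendsto_supInfty_of_lt (γ := γ) hp0 (by linarith)
      (by rw [le_div_iff₀ hp0]; linarith) hqp ?_ ?_ hL hM hK' hV'
    · rw [RadialEmbedding.qStar, ← mul_div_assoc, div_lt_iff₀ hden] at hqStar
      rw [div_lt_iff₀ hqp1]
      -- The left side equals `p (α - γ β + N) - q₂ (N - γ)`, which is negative exactly when `q₂`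
      -- exceeds `q_*`.
      have h2 : p * (α + γ * (q₂ / p - β) + N * (1 - q₂ / p)) < 0 := by
        have : p * (α + γ * (q₂ / p - β) + N * (1 - q₂ / p)) =
            p * α + γ * (q₂ - p * β) + N * (p - q₂) := by field_simp
        rw [this]
        nlinarith
      have := (pos_iff_neg_of_mul_neg h2).1 hp0
      linarith
    · exact hV.aemeasurable.comp_quasiMeasurePreserving
        (RadialEmbedding.quasiMeasurePreserving_norm hN0)
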